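/- Let $R$ be a Krull domain with quotient field $K$; that is, $R$ is an integral domain such that $R_P$ is a discrete valuation ring for every prime ideal $P$ of height one, $R = \bigcap_{\operatorname{ht} P = 1} R_P$ inside $K$ (the empty intersection being $K$, so that fields are Krull domains), and every nonzero element of $R$ lies in only finitely many prime ideals of height one. Let $A$ be a commutative flat $R$-algebra with a retraction $\Phi : A \to R$, i.e. an $R$-algebra homomorphism from $A$ to $R$, such that 1. $\operatorname{Ker} \Phi$ is a finitely generated ideal of $A$; 2. $A \otimes_R K$ is isomorphic, as a $K$-algebra, to the polynomial ring $K[X]$ in one variable; 3. $A \otimes_R k(P)$ is an integral domain for each prime ideal $P$ of $R$ of height one, where $k(P) = R_P/PR_P$. Then there exists an invertible ideal $I$ of $R$ such that $A \cong \operatorname{Sym}_R(I)$ as $R$-algebras, where $\operatorname{Sym}_R(I)$ is the symmetric algebra of the $R$-module $I$. -/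

import Mathlib

open scoped TensorProduct Polynomial nonZeroDivisors

/-- `R` is a Krull domain: the localization of `R` at each prime ideal of height one is a discrete
valuation ring; `R` is the intersection of these localizations inside its quotient field; and each
nonzero element of `R` lies in only finitely many prime ideals of height one. (A field, which has no
prime ideals of height one, is a Krull domain.) -/
class IsKrullDomain (R : Type*) [CommRing R] [IsDomain R] : Prop where
  isDiscreteValuationRing_localization : ∀ (P : Ideal R) [P.IsPrime], P.height = 1 →
    IsDiscreteValuationRing (Localization.AtPrime P)
  /-- An element `x` of the quotient field lies in `R_P` when `x * s = a` for some `a` in `R` and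
  some `s` in `R` outside `P`. -/
  mem_of_forall_mem_localization : ∀ x : FractionRing R,
    (∀ P : Ideal R, P.IsPrime → P.height = 1 → ∃ a s : R, s ∉ P ∧
      x * algebraMap R (FractionRing R) s = algebraMap R (FractionRing R) a) →
    ∃ r : R, algebraMap R (FractionRing R) r = x
  finite_height_one_primes : ∀ x : R, x ≠ 0 →
    {P : Ideal R | P.IsPrime ∧ P.height = 1 ∧ x ∈ P}.Finite

/-!
Flatness embeds `A` in `K ⊗ A = K[X]`. After a translation of `X` the retraction `Φ` is evaluation at
`X = 0`, so `Ker Φ = A ∩ X K[X]`; since it is finitely generated, the coefficients of `X` in elements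
of `A` form a finitely generated fractional ideal, and scaling `X` makes it an ideal `I` of `R`
(`Polynomial.exists_algHom_of_retraction`, `Polynomial.exists_linearMap_coeff_one`).

At a prime `P` of height one, choose `x = cX` in `A_P` with `c` minimal for divisibility, so that `x`
is not divisible by a uniformizer `π`; this is possible because linear coefficients are bounded. As
`A_P / π` is a domain with a retraction sending `x` to `0` and restricting to the identity on the
residue field, an element of `R_P[x]` divisible by `π` in `A_P` has all its coefficients divisible by
`π`. Hence `A_P = R_P[x]` (`Polynomial.exists_coeff_eq_mul_pow_at_prime`), and `I R_P = c R_P`.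

It follows that `rX` lies in every `A_P` for `r ∈ I`, and flatness of `A` over the Krull domain `R`
gives `rX ∈ A` (`IsKrullDomain.exists_eq_smul_of_flat`). Thus `I` is a direct summand of the
`R`-module `A`, hence flat, and a finitely generated flat ideal is invertible
(`Ideal.isUnit_coeIdeal_of_flat`). Finally, the coefficient of `X ^ n` in an element of `A` lies in
`c ^ n R_P` for each `P`, so it is carried into `R` by `b ^ n` for each `b ∈ I⁻¹`; this identifies `A`
with `⨁ Iⁿ Xⁿ = Sym(I)` (`SymmetricAlgebra.nonempty_algEquiv_of_isUnit_coeIdeal`).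
-/

/-! ### Discrete valuation rings -/

open Polynomial in
/-- The case of a discrete valuation ring `O`: if `S ⊆ K[X]` is an `O`-subalgebra in which `π`
generates a prime ideal, the coefficients of `1` and of `X` in elements of `S` are integral, and `S`
contains a nonzero multiple of `X`, then `S = O[cX]` for some `c` (the conclusion spells this out in
terms of coefficients). -/
theorem Polynomial.exists_coeff_eq_mul_pow_of_isDiscreteValuationRing {O K : Type*} [CommRing O]
    [IsDomain O] [IsDiscreteValuationRing O] [Field K] [Algebra O K] [IsFractionRing O K]
    (S : Subalgebra O K[X]) {π : O} (hπ : Irreducible π)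
    (h0 : ∀ f ∈ S, ∃ r : O, f.coeff 0 = algebraMap O K r)
    (h1 : ∀ f ∈ S, ∃ r : O, f.coeff 1 = algebraMap O K r)
    (hprime : ∀ f ∈ S, ∀ g ∈ S, (∃ h ∈ S, f * g = π • h) →
      (∃ h ∈ S, f = π • h) ∨ ∃ h ∈ S, g = π • h)
    (hX : ∃ r : O, r ≠ 0 ∧ r • (X : K[X]) ∈ S) :
    ∃ c : O, c ≠ 0 ∧ c • (X : K[X]) ∈ S ∧
      ∀ f ∈ S, ∀ n, ∃ d : O, f.coeff n = algebraMap O K (d * c ^ n) := by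
  have hinj : Function.Injective (algebraMap O K) := IsFractionRing.injective O K
  have hπK : algebraMap O K π ≠ 0 := by simpa using hπ.ne_zero
  have hcancel : ∀ f g : K[X], π • f = π • g → f = g := by
    intro f g h
    rw [← sub_eq_zero, ← smul_sub, ← algebraMap_smul K π, smul_eq_zero] at h
    exact sub_eq_zero.1 (h.resolve_left hπK)
  -- A multiple `c X` in `S` with `c` minimal for divisibility is not divisible by `π` in `S`.
  obtain ⟨c, ⟨hc0, hcS⟩, hmin⟩ := (wellFounded_dvdNotUnit (α := O)).has_min
    {r : O | r ≠ 0 ∧ r • (X : K[X]) ∈ S} hX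
  have hcK : algebraMap O K c ≠ 0 := by simpa using hc0
  have hcπ : ¬ ∃ h ∈ S, c • (X : K[X]) = π • h := by
    rintro ⟨h, hh, e⟩
    obtain ⟨r, hr⟩ := h1 h hh
    have e1 := congrArg (fun f => coeff f 1) e
    simp only [coeff_smul, coeff_X_one, hr] at e1
    simp only [Algebra.smul_def, mul_one, ← map_mul] at e1
    have e2 : c = π * r := hinj e1
    have e3 : h = r • (X : K[X]) := by
      apply hcancel
      rw [← e, e2, mul_smul]
    refine hmin r ⟨?_, e3 ▸ hh⟩ ⟨?_, π, hπ.not_isUnit, by rw [e2, mul_comm]⟩ <;>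
    · rintro rfl
      exact hc0 (by simpa using e2)
  have haev : ∀ p : O[X], aeval (c • (X : K[X])) p ∈ S := fun p => by
    have := (aeval (⟨c • (X : K[X]), hcS⟩ : S) p).2
    rwa [← Subalgebra.coe_val, ← aeval_algHom_apply] at this
  have hcoeff : ∀ (p : O[X]) (n : ℕ),
      (aeval (c • (X : K[X])) p).coeff n = algebraMap O K (p.coeff n * c ^ n) := by
    intro p n
    have hx : c • (X : K[X]) = C (algebraMap O K c) * X := by
      rw [← algebraMap_smul K c, smul_eq_C_mul]
    rw [← aeval_map_algebraMap K, hx, ← comp_eq_aeval, comp_C_mul_X_coeff, coeff_map, map_mul,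
      map_pow]
  -- If `p(cX) ∈ π S` then `π` divides the constant term of `p`; subtracting it and cancelling
  -- `cX ∉ π S`, which is allowed because `π` is prime in `S`, leaves the next coefficients.
  have hdvd : ∀ (n : ℕ) (p : O[X]), (∃ h ∈ S, aeval (c • (X : K[X])) p = π • h) →
      π ∣ p.coeff n := by
    intro n
    induction n with
    | zero =>
      rintro p ⟨h, hh, e⟩
      obtain ⟨r, hr⟩ := h0 h hh
      have e1 := congrArg (fun f => coeff f 0) e
      simp only [hcoeff, coeff_smul, hr] at e1
      simp only [Algebra.smul_def, ← map_mul, pow_zero, mul_one] at e1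
      exact ⟨r, hinj e1⟩
    | succ n ih =>
      rintro p ⟨h, hh, e⟩
      obtain ⟨r, hr⟩ := h0 h hh
      have e1 := congrArg (fun f => coeff f 0) e
      simp only [hcoeff, coeff_smul, hr] at e1
      simp only [Algebra.smul_def, ← map_mul, pow_zero, mul_one] at e1
      have e2 : p.coeff 0 = π * r := hinj e1
      rw [← coeff_divX]
      refine ih _ ((hprime _ hcS _ (haev _) ⟨h - algebraMap O K[X] r,
        S.sub_mem hh (S.algebraMap_mem r), ?_⟩).resolve_left hcπ)
      have e3 := congrArg (aeval (c • (X : K[X]))) (divX_mul_X_add p)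
      rw [map_add, map_mul, aeval_X, aeval_C, e2, e] at e3
      rw [smul_sub, ← e3, Algebra.smul_def π (algebraMap O K[X] r), ← map_mul]
      ring
  -- Hence `O[cX]` is saturated in `S` with respect to `π`.
  have hsat : ∀ (m : ℕ) (p : O[X]) (f : K[X]), f ∈ S → aeval (c • (X : K[X])) p = π ^ m • f →
      ∃ q : O[X], aeval (c • (X : K[X])) q = f := by
    intro m
    induction m with
    | zero => exact fun p f _ e => ⟨p, by simpa using e⟩
    | succ m ih =>
      intro p f hf e
      rw [pow_succ', mul_smul] at e
      obtain ⟨q, rfl⟩ := (C_dvd_iff_dvd_coeff π p).2 fun n => hdvd n p ⟨_, S.smul_mem hf _, e⟩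
      refine ih q f hf (hcancel _ _ ?_)
      rw [← e, map_mul, aeval_C, Algebra.smul_def]
  refine ⟨c, hc0, hcS, fun f hf n => ?_⟩
  suffices ∃ q : O[X], aeval (c • (X : K[X])) q = f by
    obtain ⟨q, rfl⟩ := this
    exact ⟨_, hcoeff q n⟩
  obtain ⟨d, hd0, hd⟩ := IsLocalization.integerNormalization_spec O⁰
    (f.comp (C (algebraMap O K c)⁻¹ * X))
  set p := IsLocalization.integerNormalization O⁰ (f.comp (C (algebraMap O K c)⁻¹ * X))
  obtain ⟨m, u, hu⟩ := IsDiscreteValuationRing.associated_pow_irreducible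
    (nonZeroDivisors.ne_zero hd0) hπ
  refine hsat m (C (u : O) * p) f hf ?_
  ext n
  have e1 := congrArg (fun f => coeff f n) hd
  simp only [coeff_map, coeff_smul, comp_C_mul_X_coeff] at e1
  simp only [hcoeff, coeff_smul, coeff_C_mul]
  rw [Algebra.smul_def] at e1 ⊢
  simp only [map_mul, e1, ← hu, map_pow, inv_pow]
  field_simp

/-! ### Flat modules over domains and Krull domains -/

/-- If `s` is a nonzerodivisor on `R / r`, then it is one on `M / r M` for every flat `M`. -/
theorem Module.Flat.exists_eq_smul_of_smul_eq_smul {R M : Type*} [CommRing R] [AddCommGroup M]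
    [Module R M] [Module.Flat R M] {r s : R} (h : ∀ y, r ∣ s * y → r ∣ y) {m m' : M}
    (e : s • m = r • m') : ∃ n : M, m = r • n := by
  obtain ⟨k, y, z, hz, hy⟩ := Module.Flat.isTrivialRelation_of_sum_smul_eq_zero
    (f := ![s, -r]) (x := ![m, m']) (by simp [e])
  have hdvd : ∀ j, r ∣ y 0 j := fun j => h _ ⟨y 1 j, by
    have := hy j
    simp only [Fin.sum_univ_two, Matrix.cons_val_zero, Matrix.cons_val_one] at this
    linear_combination this⟩
  choose c hc using hdvd
  refine ⟨∑ j, c j • z j, ?_⟩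
  have := hz 0
  simp only [Matrix.cons_val_zero] at this
  simp [this, Finset.smul_sum, hc, mul_smul]

/-- A nonzero finitely generated flat ideal of a domain is invertible. For generators `s`, `t` the
relations `s • t = t • s` hold in `I`; flatness makes them hold simultaneously over a finite free
module, which gives `t = ∑ j, aₜⱼ zⱼ` with `zⱼ ∈ I` and `s aₜⱼ = t aₛⱼ`. The fraction `bⱼ = aₜⱼ / t`
then does not depend on `t`, lies in `I⁻¹`, and `∑ j, bⱼ zⱼ = 1`. -/
theorem Ideal.isUnit_coeIdeal_of_flat {R : Type*} (K : Type*) [CommRing R] [IsDomain R] [Field K]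
    [Algebra R K] [IsFractionRing R K] (I : Ideal R) (hI : I ≠ ⊥) (hfg : I.FG) [Module.Flat R I] :
    IsUnit (I : FractionalIdeal R⁰ K) := by
  obtain ⟨T, rfl⟩ := hfg
  set I : Ideal R := Ideal.span (T : Set R) with hIT
  obtain ⟨t₀, ht₀T, ht₀⟩ : ∃ t ∈ T, t ≠ 0 := by
    by_contra! hcon
    exact hI (Ideal.span_eq_bot.2 hcon)
  have hTI : ∀ t : T, (t : R) ∈ I := fun t => Ideal.subset_span t.2
  let x : (T →₀ R) →ₗ[R] I := Finsupp.linearCombination R fun t => ⟨t, hTI t⟩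
  let f : (T × T →₀ R) →ₗ[R] (T →₀ R) := Finsupp.linearCombination R fun p =>
    Finsupp.single p.2 (p.1 : R) - Finsupp.single p.1 (p.2 : R)
  obtain ⟨k, a, y, hxy, haf⟩ :=
    Module.Flat.exists_factorization_of_comp_eq_zero_of_free (f := f) (x := x) (by
      ext p
      simp [f, x, mul_comm])
  have hrel : ∀ s t : T, ∀ j, (s : R) * a (Finsupp.single t 1) j
      = t * a (Finsupp.single s 1) j := by
    intro s t j
    have h := congrArg (fun v => v j) (LinearMap.congr_fun haf (Finsupp.single (s, t) 1))
    have hs : ∀ (t : T) (r : R), Finsupp.single t r = r • Finsupp.single t (1 : R) := by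
      intro t r
      simp
    simp only [f, LinearMap.comp_apply, Finsupp.linearCombination_single, one_smul, map_sub,
      LinearMap.zero_apply, Finsupp.coe_zero, Pi.zero_apply, Finsupp.coe_sub, Pi.sub_apply] at h
    rw [hs t, hs s, map_smul, map_smul, Finsupp.smul_apply, Finsupp.smul_apply, sub_eq_zero] at h
    exact h
  have ht₀K : algebraMap R K t₀ ≠ 0 := by simpa using ht₀
  let b : Fin k → K := fun j =>
    algebraMap R K (a (Finsupp.single ⟨t₀, ht₀T⟩ 1) j) / algebraMap R K t₀
  let z : Fin k → I := fun j => y (Finsupp.single j 1)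
  have hI0 : (I : FractionalIdeal R⁰ K) ≠ 0 := FractionalIdeal.coeIdeal_ne_zero.2 hI
  have hb : ∀ j, b j ∈ (I : FractionalIdeal R⁰ K)⁻¹ := by
    intro j
    rw [FractionalIdeal.mem_inv_iff hI0]
    intro v hv
    obtain ⟨r, hr, rfl⟩ := (FractionalIdeal.mem_coeIdeal _).1 hv
    rw [hIT] at hr
    induction hr using Submodule.span_induction with
    | mem t ht =>
      rw [FractionalIdeal.mem_one_iff]
      refine ⟨a (Finsupp.single ⟨t, ht⟩ 1) j, ?_⟩
      have := congrArg (algebraMap R K) (hrel ⟨t₀, ht₀T⟩ ⟨t, ht⟩ j)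
      simp only [map_mul] at this
      simp only [b]
      field_simp
      rw [mul_comm, this, mul_comm]
    | zero => simp
    | add u w hu hw h1 h2 =>
      rw [map_add, mul_add]
      exact Submodule.add_mem _ (h1 (FractionalIdeal.mem_coeIdeal_of_mem _ hu))
        (h2 (FractionalIdeal.mem_coeIdeal_of_mem _ hw))
    | smul c u hu h1 =>
      rw [smul_eq_mul, map_mul, mul_left_comm, ← Algebra.smul_def]
      exact Submodule.smul_mem _ c (h1 (FractionalIdeal.mem_coeIdeal_of_mem _ hu))
  have hsum : t₀ = ∑ j, a (Finsupp.single ⟨t₀, ht₀T⟩ 1) j * (z j : R) := by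
    have h := LinearMap.congr_fun hxy (Finsupp.single ⟨t₀, ht₀T⟩ 1)
    have h' := congrArg (Subtype.val) h
    simp only [x, Finsupp.linearCombination_single, one_smul, LinearMap.comp_apply] at h'
    set w := a (Finsupp.single ⟨t₀, ht₀T⟩ 1)
    have hw : w = ∑ j, w j • Finsupp.single j 1 := by
      simp [Finsupp.univ_sum_single]
    rw [hw, map_sum, AddSubmonoidClass.coe_finsetSum] at h'
    simpa only [map_smul, Submodule.coe_smul, smul_eq_mul] using h'
  rw [← FractionalIdeal.mul_inv_cancel_iff_isUnit]
  refine le_antisymm (FractionalIdeal.mul_le.2 fun i hi j hj => ?_) ?_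
  · rw [mul_comm]
    exact (FractionalIdeal.mem_inv_iff hI0).1 hj i hi
  rw [FractionalIdeal.one_le]
  have h1 : (1 : K) = ∑ j, algebraMap R K (z j) * b j := by
    have := congrArg (algebraMap R K) hsum
    rw [map_sum] at this
    rw [← div_self ht₀K]
    nth_rewrite 1 [this]
    rw [Finset.sum_div]
    refine Finset.sum_congr rfl fun j _ => ?_
    simp only [b, map_mul]
    ring
  rw [h1]
  exact Submodule.sum_mem _ fun j _ => FractionalIdeal.mul_mem_mul
    (FractionalIdeal.mem_coeIdeal_of_mem _ (z j).2) (hb j)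

/-- The intersection property of a Krull domain, in an arbitrary field of fractions. -/
theorem IsKrullDomain.mem_range_algebraMap {R : Type*} (K : Type*) [CommRing R] [IsDomain R]
    [IsKrullDomain R] [Field K] [Algebra R K] [IsFractionRing R K] {x : K}
    (h : ∀ P : Ideal R, P.IsPrime → P.height = 1 → ∃ a s : R, s ∉ P ∧
      x * algebraMap R K s = algebraMap R K a) : ∃ r : R, algebraMap R K r = x := by
  let e : FractionRing R ≃ₐ[R] K := FractionRing.algEquiv R K
  obtain ⟨r, hr⟩ := IsKrullDomain.mem_of_forall_mem_localization (e.symm x) fun P hP hP1 => by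
    obtain ⟨a, s, hs, has⟩ := h P hP hP1
    refine ⟨a, s, hs, ?_⟩
    rw [← e.symm.commutes, ← e.symm.commutes, ← map_mul, has]
  exact ⟨r, by rw [← e.commutes, hr, e.apply_symm_apply]⟩

theorem IsKrullDomain.dvd_of_forall {R : Type*} [CommRing R] [IsDomain R] [IsKrullDomain R]
    {r y : R} (hr : r ≠ 0)
    (h : ∀ P : Ideal R, P.IsPrime → P.height = 1 → r ∈ P → ∃ s ∉ P, r ∣ s * y) : r ∣ y := by
  have hinj := IsFractionRing.injective R (FractionRing R)
  have hr' : algebraMap R (FractionRing R) r ≠ 0 := by simpa using hr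
  obtain ⟨z, hz⟩ := IsKrullDomain.mem_range_algebraMap (R := R) (FractionRing R)
    (x := algebraMap R _ y / algebraMap R _ r) fun P hP hP1 => by
      by_cases hrP : r ∈ P
      · obtain ⟨s, hs, a, ha⟩ := h P hP hP1 hrP
        refine ⟨a, s, hs, ?_⟩
        field_simp
        rw [← map_mul, ← map_mul, mul_comm y, ha, mul_comm]
      · exact ⟨y, r, hrP, by field_simp⟩
  refine ⟨z, hinj ?_⟩
  rw [map_mul, hz]
  field_simp

/-- Divisibility by `r ≠ 0` in a flat module over a Krull domain can be tested at the height-one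
primes. Only the finitely many such primes containing `r` matter, and prime avoidance yields a single
`s` outside all of them with `s • m ∈ r M`; this `s` is a nonzerodivisor on `R / r`. -/
theorem IsKrullDomain.exists_eq_smul_of_flat {R M : Type*} [CommRing R] [IsDomain R]
    [IsKrullDomain R] [AddCommGroup M] [Module R M] [Module.Flat R M] {r : R} (hr : r ≠ 0) {m : M}
    (h : ∀ P : Ideal R, P.IsPrime → P.height = 1 → ∃ s ∉ P, ∃ m' : M, s • m = r • m') :
    ∃ n : M, m = r • n := by
  let D : Ideal R :=
    (LinearMap.range (LinearMap.lsmul R M r)).comap (LinearMap.toSpanSingleton R M m)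
  have hD : ∀ s, s ∈ D ↔ ∃ m' : M, s • m = r • m' := fun s => by
    simp [D, eq_comm]
  have hfin := IsKrullDomain.finite_height_one_primes r hr
  obtain ⟨s, hsD, hs⟩ : ∃ s ∈ D, ∀ P : Ideal R, P.IsPrime → P.height = 1 → r ∈ P → s ∉ P := by
    by_contra! hcon
    have := (Ideal.subset_union_prime (s := hfin.toFinset) (f := id) ⊥ ⊥
      (fun P hP _ _ => ((hfin.mem_toFinset).1 hP).1) (I := D)).1 fun s hs => by
        obtain ⟨P, hP, hP1, hrP, hsP⟩ := hcon s hs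
        exact Set.mem_biUnion (by simpa using ⟨hP, hP1, hrP⟩) hsP
    obtain ⟨P, hP, hDP⟩ := this
    obtain ⟨hP, hP1, hrP⟩ := (hfin.mem_toFinset).1 hP
    obtain ⟨s, hs, hm⟩ := h P hP hP1
    exact hs (hDP ((hD s).2 hm))
  obtain ⟨m', hm'⟩ := (hD s).1 hsD
  exact Module.Flat.exists_eq_smul_of_smul_eq_smul
    (fun y hy => IsKrullDomain.dvd_of_forall hr fun P hP hP1 hrP => ⟨s, hs P hP hP1 hrP, hy⟩) hm'

/-! ### The symmetric algebra of an invertible ideal -/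

/-- Partition of unity for an invertible ideal `I`: since `1 ∈ I I⁻¹`, an ideal containing a power of
every product `a b` with `a ∈ I` and `b ∈ I⁻¹` is the unit ideal. -/
theorem Ideal.eq_top_of_isUnit_coeIdeal {R K : Type*} [CommRing R] [IsDomain R] [Field K]
    [Algebra R K] [IsFractionRing R K] {I : Ideal R} (hI : IsUnit (I : FractionalIdeal R⁰ K))
    (D : Ideal R)
    (h : ∀ a ∈ I, ∀ b : K, (∀ r ∈ I, ∃ t : R, algebraMap R K t = b * algebraMap R K r) →
      ∀ u : R, algebraMap R K u = b * algebraMap R K a → ∃ n : ℕ, u ^ n ∈ D) : D = ⊤ := by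
  rw [← Ideal.radical_eq_top, Ideal.eq_top_iff_one]
  have hinj : Function.Injective (algebraMap R K) := IsFractionRing.injective R K
  have hI0 : (I : FractionalIdeal R⁰ K) ≠ 0 := hI.ne_zero
  have h1 : (1 : K) ∈ (I : FractionalIdeal R⁰ K) * (I : FractionalIdeal R⁰ K)⁻¹ := by
    rw [(FractionalIdeal.mul_inv_cancel_iff_isUnit K).2 hI]
    exact FractionalIdeal.one_mem_one _
  obtain ⟨r, hr, e⟩ : ∃ r ∈ D.radical, algebraMap R K r = 1 := by
    refine FractionalIdeal.mul_induction_on h1 (fun i hi j hj => ?_) fun x y hx hy => ?_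
    · obtain ⟨a, ha, rfl⟩ := (FractionalIdeal.mem_coeIdeal _).1 hi
      have hj' : ∀ r ∈ I, ∃ t : R, algebraMap R K t = j * algebraMap R K r := fun r hr =>
        (FractionalIdeal.mem_one_iff _).1
          ((FractionalIdeal.mem_inv_iff hI0).1 hj _ (FractionalIdeal.mem_coeIdeal_of_mem _ hr))
      obtain ⟨u, hu⟩ := hj' a ha
      exact ⟨u, h a ha j hj' u hu, by rw [hu, mul_comm]⟩
    · obtain ⟨r, hr, rfl⟩ := hx
      obtain ⟨s, hs, rfl⟩ := hy
      exact ⟨r + s, add_mem hr hs, map_add _ _ _⟩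
  rwa [← hinj (e.trans (map_one _).symm)]

/-- If `u M ⊆ R m`, then `Sym(M)` is generated by `m` after inverting `u`. -/
theorem SymmetricAlgebra.exists_pow_smul_eq_aeval {R M : Type*} [CommRing R] [AddCommGroup M]
    [Module R M] {u : R} {m : M} (h : ∀ x : M, ∃ t : R, u • x = t • m) (s : SymmetricAlgebra R M) :
    ∃ (n : ℕ) (p : R[X]), u ^ n • s = Polynomial.aeval (SymmetricAlgebra.ι R M m) p := by
  induction s using SymmetricAlgebra.induction with
  | algebraMap r => exact ⟨0, Polynomial.C r, by simp⟩
  | ι x =>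
    obtain ⟨t, ht⟩ := h x
    exact ⟨1, Polynomial.C t * Polynomial.X, by
      rw [pow_one, ← map_smul, ht, map_smul, map_mul, Polynomial.aeval_C, Polynomial.aeval_X,
        Algebra.smul_def]⟩
  | mul a b ha hb =>
    obtain ⟨n, p, hp⟩ := ha
    obtain ⟨k, q, hq⟩ := hb
    exact ⟨n + k, p * q, by rw [map_mul, ← hp, ← hq, pow_add, smul_mul_smul_comm]⟩
  | add a b ha hb =>
    obtain ⟨n, p, hp⟩ := ha
    obtain ⟨k, q, hq⟩ := hb
    exact ⟨n + k, u ^ k • p + u ^ n • q, by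
      rw [map_add, map_smul, map_smul, ← hp, ← hq, smul_add, smul_smul, smul_smul, ← pow_add,
        ← pow_add, add_comm k n]⟩

open Polynomial in
/-- A subalgebra `A ⊆ K[X]` that contains `I X` for an invertible ideal `I`, and in which every
coefficient of `X ^ n` is carried into `R` by the `n`-th powers of elements of `I⁻¹`, is the symmetric
algebra of `I`. For `a ∈ I`, `b ∈ I⁻¹` and `u = a b`, the map `Sym(I) → A` becomes the isomorphism
`R[a] → R[a X]` of polynomial rings after inverting `u`, and such `u` generate the unit ideal. -/
theorem SymmetricAlgebra.nonempty_algEquiv_of_isUnit_coeIdeal {R K A : Type*} [CommRing R]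
    [IsDomain R] [Field K] [Algebra R K] [IsFractionRing R K] [CommRing A] [Algebra R A]
    {φ : A →ₐ[R] K[X]} (hφ : Function.Injective φ) {I : Ideal R}
    (hI : IsUnit (I : FractionalIdeal R⁰ K)) (hIA : ∀ r ∈ I, ∃ a, φ a = r • (X : K[X]))
    (hcoeff : ∀ b : K, (∀ r ∈ I, ∃ t : R, algebraMap R K t = b * algebraMap R K r) →
      ∀ a n, ∃ t : R, algebraMap R K t = (φ a).coeff n * b ^ n) :
    Nonempty (A ≃ₐ[R] SymmetricAlgebra R I) := by
  have hinj : Function.Injective (algebraMap R K) := IsFractionRing.injective R K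
  choose! j hj using hIA
  let jl : I →ₗ[R] A :=
    { toFun := fun r => j r
      map_add' := fun r s => hφ (by
        rw [map_add, hj _ r.2, hj _ s.2, hj _ (r + s).2, Submodule.coe_add, add_smul])
      map_smul' := fun c r => hφ (by
        rw [RingHom.id_apply, map_smul, hj _ r.2, hj _ (c • r).2, Submodule.coe_smul, smul_assoc]) }
  have hjl : ∀ r : I, φ (jl r) = C (algebraMap R K r) * X := fun r => by
    rw [← smul_eq_C_mul, algebraMap_smul]
    exact hj _ r.2
  let F : SymmetricAlgebra R I →ₐ[R] A := SymmetricAlgebra.lift jl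
  have hF : ∀ r : I, φ (F (SymmetricAlgebra.ι R I r)) = C (algebraMap R K r) * X := fun r => by
    rw [← hjl]
    exact congrArg φ (SymmetricAlgebra.lift_ι_apply (f := jl) r)
  have hFp : ∀ (r : I) (p : R[X]) (n : ℕ), (φ (F (aeval (SymmetricAlgebra.ι R I r) p))).coeff n
      = algebraMap R K (p.coeff n * (r : R) ^ n) := by
    intro r p n
    rw [← aeval_algHom_apply, ← aeval_algHom_apply, hF, ← aeval_map_algebraMap K, ← comp_eq_aeval,
      comp_C_mul_X_coeff, coeff_map, map_mul, map_pow]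
  suffices hbij : Function.Bijective F from ⟨(AlgEquiv.ofBijective F hbij).symm⟩
  constructor
  · rw [injective_iff_map_eq_zero]
    intro s hs
    have hD := Ideal.eq_top_of_isUnit_coeIdeal hI
      (LinearMap.ker (LinearMap.toSpanSingleton R (SymmetricAlgebra R I) s)) fun a ha b hb u hu => by
        obtain rfl | ha0 := eq_or_ne a 0
        · obtain rfl : u = 0 := hinj (by simp [hu])
          exact ⟨1, by simp⟩
        obtain ⟨n, p, hp⟩ := SymmetricAlgebra.exists_pow_smul_eq_aeval (u := u) (m := (⟨a, ha⟩ : I))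
          (fun x => by
            obtain ⟨t, ht⟩ := hb x x.2
            refine ⟨t, Subtype.ext (hinj ?_)⟩
            simp only [Submodule.coe_smul, smul_eq_mul, map_mul, hu, ht]
            ring) s
        obtain rfl : p = 0 := by
          ext k
          have h := hFp ⟨a, ha⟩ p k
          rw [← hp, map_smul, hs, smul_zero, map_zero, coeff_zero, eq_comm,
            ← map_zero (algebraMap R K)] at h
          simpa [ha0] using hinj h
        exact ⟨n, by simpa using hp⟩
    simpa using (Ideal.eq_top_iff_one _).1 hD
  · intro f
    have hD := Ideal.eq_top_of_isUnit_coeIdeal hI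
      ((Subalgebra.toSubmodule F.range).comap (LinearMap.toSpanSingleton R A f))
      fun a ha b hb u hu => by
        choose t ht using hcoeff b hb f
        -- `u ^ N cₙ X ^ n = u ^ (N - n) (cₙ b ^ n) (a X) ^ n`, where `N` is the degree.
        refine ⟨(φ f).natDegree, aeval (SymmetricAlgebra.ι R I ⟨a, ha⟩)
          (∑ k ∈ Finset.range ((φ f).natDegree + 1),
            monomial k (u ^ ((φ f).natDegree - k) * t k)), hφ ?_⟩
        ext n
        refine (hFp _ _ n).trans ?_
        simp only [LinearMap.toSpanSingleton_apply, finsetSum_coeff, coeff_monomial, map_smul,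
          coeff_smul, Finset.sum_ite_eq', Finset.mem_range]
        rw [Algebra.smul_def]
        split_ifs with hn
        · simp only [map_mul, map_pow, ht]
          rw [← Nat.sub_add_cancel (Nat.lt_succ_iff.1 hn)]
          generalize (φ f).natDegree - n = k
          simp only [Nat.add_sub_cancel, pow_add, hu]
          ring
        · rw [coeff_eq_zero_of_natDegree_lt (by omega)]
          simp
    simpa using (Ideal.eq_top_iff_one _).1 hD

/-! ### The structure of the algebra at a prime of height one -/

open Polynomial in
/-- If `R_P` is a discrete valuation ring and the fibre of `A ⊆ K[X]` at `P` is a domain, then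
`A_P = R_P[cX]` for some `c`, which can be taken in `R` with `cX ∈ A`. The localization `A_P` is
encoded as the `R_P`-subalgebra of all `f ∈ K[X]` with `s f ∈ A` for some `s ∉ P`. -/
theorem Polynomial.exists_coeff_eq_mul_pow_at_prime {R K A : Type*} [CommRing R]
    [IsDomain R] [Field K] [Algebra R K] [IsFractionRing R K] [CommRing A] [Algebra R A]
    {φ : A →ₐ[R] K[X]} (hφ : Function.Injective φ)
    (h0 : ∀ a, ∃ r : R, (φ a).coeff 0 = algebraMap R K r)
    (h1 : ∀ a, ∃ r : R, (φ a).coeff 1 = algebraMap R K r)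
    (hX : ∃ r : R, r ≠ 0 ∧ ∃ a, φ a = r • (X : K[X]))
    (P : Ideal R) [P.IsPrime] [IsDiscreteValuationRing (Localization.AtPrime P)]
    [IsDomain (P.ResidueField ⊗[R] A)] :
    ∃ c : R, c ≠ 0 ∧ (∃ a, φ a = c • (X : K[X])) ∧
      ∀ a n, ∃ d s : R, s ∉ P ∧ s • (φ a).coeff n = algebraMap R K (d * c ^ n) := by
  let O := Localization.AtPrime P
  have hinj : Function.Injective (algebraMap R K) := IsFractionRing.injective R K
  let : Algebra O K := (IsLocalization.lift (M := P.primeCompl) (g := algebraMap R K)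
    fun y => by
      rw [isUnit_iff_ne_zero, Ne, map_eq_zero_iff _ hinj]
      rintro h
      exact y.2 (h ▸ P.zero_mem)).toAlgebra
  have : IsScalarTower R O K := IsScalarTower.of_algebraMap_eq fun r => by
    rw [RingHom.algebraMap_toAlgebra, IsLocalization.lift_eq]
  have : IsFractionRing O K :=
    IsFractionRing.isFractionRing_of_isDomain_of_isLocalization P.primeCompl O K
  have hunit : ∀ s ∉ P, IsUnit (algebraMap R O s) := fun s hs =>
    IsLocalization.map_units O (⟨s, hs⟩ : P.primeCompl)
  have hsurj : ∀ x : O, ∃ r : R, ∃ s ∉ P, s • x = algebraMap R O r := fun x => by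
    obtain ⟨⟨r, s⟩, h⟩ := IsLocalization.surj P.primeCompl x
    exact ⟨r, s, s.2, by rw [Algebra.smul_def, mul_comm, h]⟩
  have hP : ∀ {s t : R}, s ∉ P → t ∉ P → s * t ∉ P := fun hs ht h =>
    (Ideal.IsPrime.mem_or_mem ‹_› h).elim hs ht
  have h1P : (1 : R) ∉ P := fun h => Ideal.IsPrime.ne_top ‹_› ((Ideal.eq_top_iff_one P).2 h)
  have hdesc : ∀ k : K, (∃ r : R, ∃ s ∉ P, s • k = algebraMap R K r) →
      ∃ x : O, k = algebraMap O K x := by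
    rintro k ⟨r, s, hs, e⟩
    obtain ⟨u, hu⟩ := hunit s hs
    refine ⟨↑u⁻¹ * algebraMap R O r, ?_⟩
    rw [map_mul, ← IsScalarTower.algebraMap_apply, ← e, ← algebraMap_smul O s, ← hu,
      Algebra.smul_def, ← mul_assoc, ← map_mul, Units.inv_mul, map_one, one_mul]
  let S : Subalgebra O K[X] :=
    { carrier := {f | ∃ s ∉ P, ∃ a, s • f = φ a}
      mul_mem' := by
        rintro f g ⟨s, hs, a, ha⟩ ⟨t, ht, b, hb⟩
        exact ⟨s * t, hP hs ht, a * b, by rw [map_mul, ← ha, ← hb, smul_mul_smul_comm]⟩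
      add_mem' := by
        rintro f g ⟨s, hs, a, ha⟩ ⟨t, ht, b, hb⟩
        exact ⟨s * t, hP hs ht, t • a + s • b, by
          rw [map_add, map_smul, map_smul, ← ha, ← hb, smul_add, smul_smul, smul_smul,
            mul_comm s t]⟩
      algebraMap_mem' := by
        intro x
        obtain ⟨r, s, hs, e⟩ := hsurj x
        refine ⟨s, hs, algebraMap R A r, ?_⟩
        rw [AlgHom.commutes, IsScalarTower.algebraMap_apply R O K[X], ← e, Algebra.smul_def,
          Algebra.smul_def, map_mul, ← IsScalarTower.algebraMap_apply] }
  have hφS : ∀ a, φ a ∈ S := fun a => ⟨1, h1P, a, one_smul _ _⟩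
  obtain ⟨π, hπ⟩ := IsDiscreteValuationRing.exists_irreducible O
  have hmax := (IsDiscreteValuationRing.irreducible_iff_uniformizer π).1 hπ
  -- The kernel of `A → k(P) ⊗ A` lands in `π S`.
  have hker : ∀ a : A, (1 : P.ResidueField) ⊗ₜ[R] a = 0 → ∃ h ∈ S, φ a = π • h := by
    intro a ha
    let ψ : O ⊗[R] A →ₐ[O] K[X] := Algebra.TensorProduct.lift (Algebra.ofId O K[X]) φ
      fun _ _ => Commute.all _ _
    have hψ : ∀ w, ψ w ∈ S := by
      intro w
      induction w using TensorProduct.induction_on with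
      | zero => simp
      | tmul x a =>
        rw [Algebra.TensorProduct.lift_tmul]
        exact S.mul_mem (S.algebraMap_mem x) (hφS a)
      | add x y hx hy => rw [map_add]; exact S.add_mem hx hy
    have hres := Algebra.TensorProduct.rTensor_ker (R := R) (S := R) (C := A)
      (IsScalarTower.toAlgHom R O P.ResidueField) (IsLocalRing.residue_surjective)
    have hmem : (1 : O) ⊗ₜ[R] a ∈ RingHom.ker (Algebra.TensorProduct.map
        (IsScalarTower.toAlgHom R O P.ResidueField) (AlgHom.id R A)) := by
      rw [RingHom.mem_ker]
      simpa using ha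
    have hk : RingHom.ker (IsScalarTower.toAlgHom R O P.ResidueField) = Ideal.span {π} := by
      rw [← hmax]
      exact IsLocalRing.ker_residue
    rw [hres, hk, Ideal.map_span, Set.image_singleton, Ideal.mem_span_singleton'] at hmem
    obtain ⟨w, hw⟩ := hmem
    refine ⟨ψ w, hψ w, ?_⟩
    have := congrArg ψ hw
    rw [map_mul] at this
    simp only [Algebra.TensorProduct.includeLeft_apply, ψ, Algebra.TensorProduct.lift_tmul] at this
    simpa [Algebra.smul_def, mul_comm, Algebra.ofId_apply] using this.symm
  have hprime : ∀ f ∈ S, ∀ g ∈ S, (∃ h ∈ S, f * g = π • h) →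
      (∃ h ∈ S, f = π • h) ∨ ∃ h ∈ S, g = π • h := by
    rintro f ⟨s, hs, a, ha⟩ g ⟨t, ht, b, hb⟩ ⟨h, ⟨u, hu, c, hc⟩, e⟩
    have hdiv : ∀ {s f a}, s ∉ P → s • f = φ a → (∃ h ∈ S, φ a = π • h) → ∃ h ∈ S, f = π • h := by
      rintro s f a hs ha ⟨h, hh, e⟩
      obtain ⟨v, hv⟩ := hunit s hs
      refine ⟨(↑v⁻¹ : O) • h, S.smul_mem hh _, ?_⟩
      rw [smul_comm, ← e, ← ha, ← algebraMap_smul O s, ← hv, smul_smul, Units.inv_mul, one_smul]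
    obtain ⟨p, v, hv, hp⟩ := hsurj π
    have hpP : p ∈ P := by
      have : algebraMap R O p ∈ IsLocalRing.maximalIdeal O := by
        rw [hmax, ← hp]
        exact Ideal.mem_span_singleton.2 (Dvd.intro_left _ (Algebra.smul_def v π).symm)
      exact (IsLocalization.AtPrime.to_map_mem_maximal_iff O P p).1 this
    -- Clear the denominators in `f g = π h` to get an equation in `A` that can be reduced modulo `P`.
    have hA : (v * u) • (a * b) = (s * t * p) • c := by
      apply hφ
      rw [map_smul, map_smul, map_mul, ← ha, ← hb, ← hc, smul_mul_smul_comm, e]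
      simp only [← algebraMap_smul O (_ : R) (_ : K[X]), smul_smul, map_mul]
      rw [← hp, Algebra.smul_def v π]
      congr 1
      ring
    have hk : ((1 : P.ResidueField) ⊗ₜ[R] a) * ((1 : P.ResidueField) ⊗ₜ[R] b) = 0 := by
      have hz : (v * u) • ((1 : P.ResidueField) ⊗ₜ[R] (a * b)) = 0 := by
        rw [← TensorProduct.tmul_smul, hA, ← TensorProduct.smul_tmul, Algebra.smul_def]
        simp [Ideal.algebraMap_residueField_eq_zero.2 hpP]
      have hvu : algebraMap R P.ResidueField (v * u) ≠ 0 := fun h =>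
        hP hv hu (Ideal.algebraMap_residueField_eq_zero.1 h)
      rw [Algebra.TensorProduct.tmul_mul_tmul, one_mul]
      rw [← algebraMap_smul P.ResidueField (v * u)] at hz
      exact (IsUnit.smul_eq_zero (isUnit_iff_ne_zero.2 hvu)).1 hz
    exact (mul_eq_zero.1 hk).imp (fun h => hdiv hs ha (hker a h)) fun h => hdiv ht hb (hker b h)
  obtain ⟨c, hc0, hcS, hcoeff⟩ := exists_coeff_eq_mul_pow_of_isDiscreteValuationRing S hπ
    (by
      rintro f ⟨s, hs, a, ha⟩
      obtain ⟨r, hr⟩ := h0 a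
      exact hdesc _ ⟨r, s, hs, by rw [← coeff_smul, ha, hr]⟩)
    (by
      rintro f ⟨s, hs, a, ha⟩
      obtain ⟨r, hr⟩ := h1 a
      exact hdesc _ ⟨r, s, hs, by rw [← coeff_smul, ha, hr]⟩) hprime
    (by
      obtain ⟨r, hr, a, ha⟩ := hX
      refine ⟨algebraMap R O r, ?_, ?_⟩
      · rwa [Ne, map_eq_zero_iff _ (IsLocalization.injective O P.primeCompl_le_nonZeroDivisors)]
      · rw [algebraMap_smul, ← ha]
        exact hφS a)
  obtain ⟨t, ht, a, ha⟩ := hcS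
  obtain ⟨r, s, hs, hr⟩ := hsurj c
  have hts := hP ht hs
  -- Replacing `c` by a unit multiple puts it in `R` and `c X` in the image of `A`.
  have hc' : algebraMap R O (t * r) = algebraMap R O (t * s) * c := by
    rw [map_mul, ← hr, Algebra.smul_def, map_mul, mul_assoc]
  refine ⟨t * r, ?_, ⟨s • a, ?_⟩, fun a n => ?_⟩
  · intro h
    rw [h, map_zero, eq_comm, mul_eq_zero] at hc'
    exact hc'.elim (hunit _ hts).ne_zero hc0
  · rw [map_smul, ← ha, ← algebraMap_smul O (t * r), hc', ← algebraMap_smul O s,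
      ← algebraMap_smul O t, smul_smul, smul_smul, map_mul]
    congr 1
    ring
  · obtain ⟨d, hd⟩ := hcoeff _ (hφS a) n
    obtain ⟨d', s', hs', hd'⟩ := hsurj d
    have hpow : (t * s) ^ n ∉ P := fun h => hts (Ideal.IsPrime.mem_of_pow_mem ‹_› n h)
    refine ⟨d', s' * (t * s) ^ n, hP hs' hpow, ?_⟩
    rw [hd, IsScalarTower.algebraMap_apply R O K (d' * _), map_mul (algebraMap R O), ← hd',
      map_pow, hc', ← algebraMap_smul O (s' * _), Algebra.smul_def, ← map_mul]
    congr 1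
    rw [Algebra.smul_def, map_mul, map_pow]
    ring

/-! ### The coordinate and the ideal of linear coefficients -/

theorem TensorProduct.exists_one_tmul_eq_smul {R : Type*} (K : Type*) {A : Type*} [CommRing R]
    [IsDomain R] [Field K] [Algebra R K] [IsFractionRing R K] [AddCommGroup A] [Module R A]
    (x : K ⊗[R] A) : ∃ r : R, r ≠ 0 ∧ ∃ a : A, (1 : K) ⊗ₜ[R] a = r • x := by
  induction x using TensorProduct.induction_on with
  | zero => exact ⟨1, one_ne_zero, 0, by simp⟩
  | tmul k a =>
    obtain ⟨⟨r, s⟩, h⟩ := IsLocalization.surj R⁰ k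
    refine ⟨s, nonZeroDivisors.ne_zero s.2, r • a, ?_⟩
    rw [← TensorProduct.smul_tmul, TensorProduct.smul_tmul', _root_.Algebra.smul_def, mul_one, ← h,
      _root_.Algebra.smul_def, mul_comm]
  | add x y hx hy =>
    obtain ⟨r, hr, a, ha⟩ := hx
    obtain ⟨s, hs, b, hb⟩ := hy
    refine ⟨r * s, mul_ne_zero hr hs, s • a + r • b, ?_⟩
    rw [TensorProduct.tmul_add, TensorProduct.tmul_smul, TensorProduct.tmul_smul, ha, hb, smul_add,
      smul_smul, smul_smul, mul_comm s r]

open Polynomial in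
/-- A coordinate adapted to the retraction: `A` embeds in `K[X]` so that `Φ` becomes evaluation at
`X = 0`, with `K A = K[X]`, and the generators of `Ker Φ` have linear coefficients in `R`. The
coordinate is obtained from an arbitrary one by a translation and by scaling with a common
denominator `d`. -/
theorem Polynomial.exists_algHom_of_retraction {R K A : Type*} [CommRing R] [IsDomain R]
    [Field K] [Algebra R K] [IsFractionRing R K] [CommRing A] [Algebra R A] [Module.Flat R A]
    (Φ : A →ₐ[R] R) (hker : (RingHom.ker Φ).FG) (e : K ⊗[R] A ≃ₐ[K] K[X]) :
    ∃ φ : A →ₐ[R] K[X], Function.Injective φ ∧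
      (∀ a, (φ a).coeff 0 = algebraMap R K (Φ a)) ∧
      (∀ f : K[X], ∃ r : R, r ≠ 0 ∧ ∃ a, φ a = r • f) ∧
      ∃ T : Finset A, Ideal.span (T : Set A) = RingHom.ker Φ ∧
        ∀ t ∈ T, ∃ r : R, (φ t).coeff 1 = algebraMap R K r := by
  have hinj : Function.Injective (algebraMap R K) := IsFractionRing.injective R K
  let ρ : K ⊗[R] A →ₐ[K] K := Algebra.TensorProduct.lift (AlgHom.id K K)
    ((Algebra.ofId R K).comp Φ) fun _ _ => Commute.all _ _
  let α : K := ρ (e.symm X)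
  have hρ : ∀ x, ρ x = aeval α (e x) := by
    have : ρ.comp e.symm.toAlgHom = aeval α := by
      ext
      simp [α]
    intro x
    rw [← this]
    simp
  have key : ∀ d : K, d ≠ 0 → ∃ φ : A →ₐ[R] K[X], Function.Injective φ ∧
      (∀ a, (φ a).coeff 0 = algebraMap R K (Φ a)) ∧
      (∀ f : K[X], ∃ r : R, r ≠ 0 ∧ ∃ a, φ a = r • f) ∧
      ∀ a, φ a = (e (1 ⊗ₜ a)).comp (C d * X + C α) := by
    intro d hd
    have : Invertible d := invertibleOfNonzero hd
    let E : K ⊗[R] A ≃ₐ[K] K[X] := e.trans (algEquivCMulXAddC d α)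
    have hE : ∀ a, E a = (e a).comp (C d * X + C α) := fun a => by
      simp [E, comp_eq_aeval]
    refine ⟨(E.toAlgHom.restrictScalars R).comp Algebra.TensorProduct.includeRight,
      E.injective.comp (Algebra.TensorProduct.includeRight_injective hinj), fun a => ?_,
      fun f => ?_, fun a => hE _⟩
    · have := hρ (1 ⊗ₜ a)
      simp only [ρ, Algebra.TensorProduct.lift_tmul, map_one, one_mul] at this
      change (E (1 ⊗ₜ a)).coeff 0 = _
      rw [hE, coeff_zero_eq_eval_zero, eval_comp]
      simpa [aeval_def, eval₂_eq_eval_map, Algebra.ofId_apply] using this.symm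
    · obtain ⟨r, hr, a, ha⟩ := TensorProduct.exists_one_tmul_eq_smul (R := R) K (E.symm f)
      refine ⟨r, hr, a, ?_⟩
      change E (1 ⊗ₜ a) = _
      rw [ha, ← algebraMap_smul K r (E.symm f), map_smul, E.apply_symm_apply, algebraMap_smul]
  obtain ⟨T, hT⟩ := hker
  obtain ⟨⟨d, hd⟩, hdT⟩ := IsLocalization.exist_integer_multiples R⁰ T
    (fun t => ((e (1 ⊗ₜ t)).comp (X + C α)).coeff 1)
  obtain ⟨φ, h1, h2, h3, h4⟩ := key (algebraMap R K d) (by simpa using nonZeroDivisors.ne_zero hd)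
  refine ⟨φ, h1, h2, h3, T, hT, fun t ht => ?_⟩
  obtain ⟨r, hr⟩ := hdT t ht
  refine ⟨r, ?_⟩
  have : (C (algebraMap R K d) * X + C α : K[X])
      = (X + C α).comp (C (algebraMap R K d) * X) := by simp
  rw [hr, h4, this, ← comp_assoc, comp_C_mul_X_coeff, pow_one, mul_comm]
  exact (Algebra.smul_def _ _).symm

open Polynomial in
/-- When `Φ` is evaluation at `X = 0`, taking the coefficient of `X` is a derivation along `Φ`; so if
the generators of `Ker Φ` have linear coefficients in `R`, all elements do, and these coefficients form
a finitely generated ideal. -/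
theorem Polynomial.exists_linearMap_coeff_one {R K A : Type*} [CommRing R] [Field K] [Algebra R K]
    [FaithfulSMul R K] [CommRing A] [Algebra R A] (Φ : A →ₐ[R] R) {φ : A →ₐ[R] K[X]}
    (h0 : ∀ a, (φ a).coeff 0 = algebraMap R K (Φ a)) {T : Finset A}
    (hT : Ideal.span (T : Set A) = RingHom.ker Φ)
    (hT1 : ∀ t ∈ T, ∃ r : R, (φ t).coeff 1 = algebraMap R K r) :
    ∃ L : A →ₗ[R] R, (∀ a, (φ a).coeff 1 = algebraMap R K (L a)) ∧ (LinearMap.range L).FG := by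
  have hinj : Function.Injective (algebraMap R K) := FaithfulSMul.algebraMap_injective R K
  have hmul : ∀ a b, (φ (a * b)).coeff 1
      = algebraMap R K (Φ a) * (φ b).coeff 1 + algebraMap R K (Φ b) * (φ a).coeff 1 := by
    intro a b
    rw [map_mul, coeff_mul, Finset.Nat.antidiagonal_succ]
    simp [h0, mul_comm]
  -- The coefficient of `X` in `φ a` lies in the ideal of `R` generated by those for `a ∈ T`.
  have hspan : ∀ a, ∃ r : R, (φ a).coeff 1 = algebraMap R K r ∧
      r ∈ Ideal.span {r : R | ∃ t ∈ T, (φ t).coeff 1 = algebraMap R K r} := by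
    intro a
    have ha : a - algebraMap R A (Φ a) ∈ Ideal.span (T : Set A) := by
      rw [hT, RingHom.mem_ker]
      simp
    have hsub : (φ (a - algebraMap R A (Φ a))).coeff 1 = (φ a).coeff 1 := by
      rw [map_sub, AlgHom.commutes, coeff_sub, Polynomial.algebraMap_apply, coeff_C_succ, sub_zero]
    rw [← hsub]
    generalize a - algebraMap R A (Φ a) = x at ha
    induction ha using Submodule.span_induction with
    | mem t ht =>
      obtain ⟨r, hr⟩ := hT1 t ht
      exact ⟨r, hr, Ideal.subset_span ⟨t, ht, hr⟩⟩
    | zero => exact ⟨0, by simp, zero_mem _⟩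
    | add x y _ _ hx hy =>
      obtain ⟨r, hr, hr'⟩ := hx
      obtain ⟨s, hs, hs'⟩ := hy
      exact ⟨r + s, by rw [map_add, coeff_add, hr, hs, map_add], add_mem hr' hs'⟩
    | smul c x hx h =>
      obtain ⟨r, hr, hr'⟩ := h
      have hx0 : Φ x = 0 := by
        have : x ∈ Ideal.span (T : Set A) := hx
        rwa [hT, RingHom.mem_ker] at this
      exact ⟨Φ c * r, by rw [smul_eq_mul, hmul, hx0, hr, map_zero, zero_mul, add_zero, map_mul],
        Ideal.mul_mem_left _ _ hr'⟩
  choose l hl hlspan using hspan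
  let L : A →ₗ[R] R :=
    { toFun := l
      map_add' := fun a b => hinj (by rw [← hl, map_add, map_add, coeff_add, hl, hl])
      map_smul' := fun r a => hinj (by
        rw [← hl, map_smul, coeff_smul, hl, RingHom.id_apply, smul_eq_mul, map_mul,
          Algebra.smul_def]) }
  refine ⟨L, hl, ?_⟩
  have hfin : {r : R | ∃ t ∈ T, (φ t).coeff 1 = algebraMap R K r}.Finite := by
    refine (T.finite_toSet.image l).subset ?_
    rintro r ⟨t, ht, hr⟩
    exact ⟨t, ht, hinj (by rw [← hl, hr])⟩
  have hIeq : LinearMap.range L = Ideal.span {r : R | ∃ t ∈ T, (φ t).coeff 1 = algebraMap R K r} := by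
    refine le_antisymm ?_ (Ideal.span_le.2 ?_)
    · rintro _ ⟨a, rfl⟩
      exact hlspan a
    · rintro r ⟨t, -, hr⟩
      exact ⟨t, hinj ((hl t).symm.trans hr)⟩
  rw [hIeq]
  exact ⟨hfin.toFinset, by simp⟩

open Polynomial in
/-- The theorem in terms of an embedding `A ⊆ K[X]` for which `Φ` is evaluation at `X = 0`; the ideal
is that of all linear coefficients of elements of `A`. -/
theorem Polynomial.exists_nonempty_algEquiv_symmetricAlgebra {R K A : Type*} [CommRing R]
    [IsDomain R] [IsKrullDomain R] [Field K] [Algebra R K] [IsFractionRing R K] [CommRing A]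
    [Algebra R A] [Module.Flat R A] (Φ : A →ₐ[R] R) {φ : A →ₐ[R] K[X]}
    (hφ : Function.Injective φ) (h0 : ∀ a, (φ a).coeff 0 = algebraMap R K (Φ a))
    (hdense : ∀ f : K[X], ∃ r : R, r ≠ 0 ∧ ∃ a, φ a = r • f) {T : Finset A}
    (hT : Ideal.span (T : Set A) = RingHom.ker Φ)
    (hT1 : ∀ t ∈ T, ∃ r : R, (φ t).coeff 1 = algebraMap R K r)
    (hfiber : ∀ (P : Ideal R) [P.IsPrime], P.height = 1 → IsDomain (P.ResidueField ⊗[R] A)) :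
    ∃ I : Ideal R, IsUnit (I : FractionalIdeal R⁰ K) ∧
      Nonempty (A ≃ₐ[R] SymmetricAlgebra R I) := by
  have hinj : Function.Injective (algebraMap R K) := IsFractionRing.injective R K
  obtain ⟨L, hl, hIfg⟩ := exists_linearMap_coeff_one Φ h0 hT hT1
  let I : Ideal R := LinearMap.range L
  have hlX : ∀ {a r}, φ a = r • (X : K[X]) → L a = r := fun {a r} h => hinj (by
    rw [← hl, h, coeff_smul, coeff_X_one, Algebra.smul_def, mul_one])
  have hI : I ≠ ⊥ := by
    obtain ⟨r, hr, a, ha⟩ := hdense X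
    intro h
    have : r ∈ I := ⟨a, hlX ha⟩
    rw [h] at this
    exact hr this
  have hloc : ∀ P : Ideal R, P.IsPrime → P.height = 1 → ∃ c : R, c ≠ 0 ∧
      (∃ a, φ a = c • (X : K[X])) ∧
      ∀ a n, ∃ d s : R, s ∉ P ∧ s • (φ a).coeff n = algebraMap R K (d * c ^ n) := by
    intro P hP hP1
    have := IsKrullDomain.isDiscreteValuationRing_localization P hP1
    have := hfiber P hP1
    exact exists_coeff_eq_mul_pow_at_prime hφ (fun a => ⟨_, h0 a⟩) (fun a => ⟨_, hl a⟩) (hdense X) P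
  -- `r X ∈ A_P` for all `P` of height one, so `r X ∈ A` by flatness.
  have hIX : ∀ r ∈ I, ∃ a, φ a = r • (X : K[X]) := by
    rintro _ ⟨a, rfl⟩
    obtain ⟨t, ht, m, hm⟩ := hdense (L a • X)
    obtain ⟨n, rfl⟩ := IsKrullDomain.exists_eq_smul_of_flat ht (m := m) fun P hP hP1 => by
      obtain ⟨c, -, ⟨b, hb⟩, hc⟩ := hloc P hP hP1
      obtain ⟨d, s, hs, hd⟩ := hc a 1
      refine ⟨s, hs, d • b, hφ ?_⟩
      have hsl : s * L a = d * c := hinj (by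
        rw [map_mul, ← Algebra.smul_def]
        rw [← hl, hd, pow_one])
      rw [map_smul, map_smul, map_smul, hm, hb, smul_comm, smul_smul s, smul_smul d, hsl]
    refine ⟨n, ?_⟩
    rw [map_smul, ← sub_eq_zero, ← smul_sub, ← algebraMap_smul K t, smul_eq_zero] at hm
    exact sub_eq_zero.1 (hm.resolve_left (by simpa using ht))
  -- `r ↦ r X` and `L` exhibit `I` as a direct summand of `A`.
  have : Module.Flat R I := by
    choose! j hj using hIX
    let J : I →ₗ[R] A :=
      { toFun := fun r => j r
        map_add' := fun r s => hφ (by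
          rw [map_add, hj _ r.2, hj _ s.2, hj _ (r + s).2, Submodule.coe_add, add_smul])
        map_smul' := fun c r => hφ (by
          rw [RingHom.id_apply, map_smul, hj _ r.2, hj _ (c • r).2, Submodule.coe_smul,
            smul_assoc]) }
    exact Module.Flat.of_retract J L.rangeRestrict
      (LinearMap.ext fun r => Subtype.ext (hlX (hj r r.2)))
  have hIunit := Ideal.isUnit_coeIdeal_of_flat K I hI hIfg
  refine ⟨I, hIunit, SymmetricAlgebra.nonempty_algEquiv_of_isUnit_coeIdeal hφ hIunit hIX ?_⟩
  -- If `b I ⊆ R` then `b c ∈ R`, and `s cₙ ∈ R c ^ n` for some `s ∉ P` gives `cₙ b ^ n ∈ R_P`.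
  intro b hb a n
  refine IsKrullDomain.mem_range_algebraMap K fun P hP hP1 => ?_
  obtain ⟨c, -, ⟨x, hx⟩, hc⟩ := hloc P hP hP1
  obtain ⟨d, s, hs, hd⟩ := hc a n
  obtain ⟨t, ht⟩ := hb c ⟨x, hlX hx⟩
  refine ⟨d * t ^ n, s, hs, ?_⟩
  rw [Algebra.smul_def] at hd
  rw [mul_comm, ← mul_assoc, hd, map_mul, map_mul, map_pow, map_pow, ht]
  ring

theorem theorem3p7 {R K A : Type*} [CommRing R] [IsDomain R] [IsKrullDomain R]
    [Field K] [Algebra R K] [IsFractionRing R K]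
    [CommRing A] [Algebra R A] [Module.Flat R A]
    (Φ : A →ₐ[R] R)
    (hker : (RingHom.ker Φ).FG)
    (hgeneric : Nonempty (K ⊗[R] A ≃ₐ[K] K[X]))
    (hfiber : ∀ (P : Ideal R) [P.IsPrime], P.height = 1 → IsDomain (P.ResidueField ⊗[R] A)) :
    ∃ I : Ideal R, IsUnit (I : FractionalIdeal R⁰ K) ∧
      Nonempty (A ≃ₐ[R] SymmetricAlgebra R I) := by
  obtain ⟨e⟩ := hgeneric
  obtain ⟨φ, hφ, h0, hdense, T, hT, hT1⟩ := Polynomial.exists_algHom_of_retraction Φ hker e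
  exact Polynomial.exists_nonempty_algEquiv_symmetricAlgebra Φ hφ h0 hdense hT hT1 hfiber
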